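/- \textbf{Lemma (Riemannian quadratic upper bound).} Let $\mathcal{M}\subset\mathbb{R}^{d\times r}$ be a compact smooth embedded submanifold, where $\mathbb{R}^{d\times r}$ carries the Euclidean (Frobenius) inner product $\langle\cdot,\cdot\rangle$ and norm $\|\cdot\|$, and $\mathcal{M}$ carries the induced Riemannian metric. Let $\gamma>0$ be such that $\mathcal{M}$ is $2\gamma$-proximally smooth, i.e. $\mathcal{M}$ is closed and every $x\in\mathbb{R}^{d\times r}$ with $\mathrm{dist}(x,\mathcal{M})<2\gamma$ has exactly one nearest point in $\mathcal{M}$. For $x\in\mathcal{M}$ let $\mathcal{P}_{T_x\mathcal{M}}$ be the orthogonal projection onto the tangent space $T_x\mathcal{M}$, and for $f$ differentiable at $x$ let $\mathrm{grad} f(x)\in T_x\mathcal{M}$ be the Riemannian gradient of $f|_{\mathcal{M}}$, i.e. $\langle \mathrm{grad} f(x),\xi\rangle=\mathrm{D}f(x)[\xi]$ for all $\xi\in T_x\mathcal{M}$. Then the map $x\mapsto\mathcal{P}_{T_x\mathcal{M}}$ is Lipschitz on $\mathcal{M}$: there is a constant $L_{\mathcal{P}}>0$ with $\|\mathcal{P}_{T_x\mathcal{M}}-\mathcal{P}_{T_y\mathcal{M}}\|_{\mathrm{op}}\le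 L_{\mathcal{P}}\|x-y\|$ for all $x,y\in\mathcal{M}$. Moreover, let $f_1,\dots,f_n:\mathbb{R}^{d\times r}\to\mathbb{R}$ be differentiable at every point of the convex hull $\mathrm{conv}(\mathcal{M})$, and suppose that for all $i\in\{1,\dots,n\}$ $$\|\nabla f_i(x)-\nabla f_i(y)\|\le L_f\|x-y\|\quad\forall x,y\in\mathrm{conv}(\mathcal{M}),\qquad \|\nabla f_i(x)\|\le L_G\quad\forall x\in\mathcal{M}.$$ Then for all $i$ and all $x,y\in\mathcal{M}$, $$f_i(y)-f_i(x)\le\langle\mathrm{grad} f_i(x),y-x\rangle+\frac{L_g}{2}\|y-x\|^2,\qquad L_g:=L_f+\frac{1}{2\gamma}L_G,$$ and, for every constant $L_{\mathcal{P}}>0$ as above (it depends only on $\mathcal{M}$, not on the functions $f_i$), $$\|\mathrm{grad} f_i(x)-\mathrm{grad} f_i(y)\|\le(L_f+L_GL_{\mathcal{P}})\|x-y\|.$$ -/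

import Mathlib

open scoped ContDiff Gradient

noncomputable section

namespace RiemannianBound

/-- The matrix space of size `d × r` over the reals with the Frobenius (Euclidean) inner product. -/
abbrev MatSpace (d r : ℕ) : Type := EuclideanSpace ℝ (Fin d × Fin r)

variable {E : Type*} [NormedAddCommGroup E] [InnerProductSpace ℝ E] [FiniteDimensional ℝ E]

/-- `M` is a smooth embedded submanifold of `E` of codimension `k`: near each of its points it is
the zero set of a smooth submersion into `k`-dimensional Euclidean space. -/
def IsSmoothSubmanifold (k : ℕ) (M : Set E) : Prop :=
  ∀ x ∈ M, ∃ U : Set E, IsOpen U ∧ x ∈ U ∧ ∃ h : E → EuclideanSpace ℝ (Fin k),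
    ContDiffOn ℝ ∞ h U ∧ (∀ y ∈ U, Function.Surjective (fderiv ℝ h y)) ∧
    M ∩ U = {y ∈ U | h y = 0}

/-- The tangent space of `M` at `x`: the velocities at time `0` of curves that stay in `M` near time
`0`, pass through `x` and are differentiable there. For a submanifold these velocities already form
a linear subspace; the span only makes the definition meaningful for arbitrary sets. -/
def tangentSpace (M : Set E) (x : E) : Submodule ℝ E :=
  Submodule.span ℝ {v | ∃ c : ℝ → E, c 0 = x ∧ (∀ᶠ t in nhds 0, c t ∈ M) ∧ HasDerivAt c v 0}

/-- The Riemannian gradient at `x` of `f` restricted to `M`, for the metric induced by `E`: the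
vector of the tangent space that represents the differential of `f` on the tangent space. -/
def riemannianGradient (M : Set E) (f : E → ℝ) (x : E) : E :=
  (((InnerProductSpace.toDual ℝ (tangentSpace M x)).symm
    ((fderiv ℝ f x).comp (tangentSpace M x).subtypeL) : tangentSpace M x) : E)

/-- The set of nearest points of `M` to `x`. -/
def nearestPoints (M : Set E) (x : E) : Set E :=
  {y ∈ M | ∀ z ∈ M, ‖y - x‖ ≤ ‖z - x‖}

/-- `M` is `R`-proximally smooth: it is closed, and every point at distance less than `R` from `M`
has exactly one nearest point in `M`. -/
def IsProximallySmooth (R : ℝ) (M : Set E) : Prop :=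
  IsClosed M ∧ ∀ x : E, Metric.infDist x M < R → ∃! y, y ∈ nearestPoints M x

/-- `L` is a Lipschitz modulus over `M` of the map sending `x` to the orthogonal projection onto the
tangent space at `x`, in the operator norm. -/
def IsTangentProjectionModulus (M : Set E) (L : ℝ) : Prop :=
  ∀ x ∈ M, ∀ y ∈ M,
    ‖(tangentSpace M x).starProjection - (tangentSpace M y).starProjection‖ ≤ L * ‖x - y‖

/-- The functions `f i` are differentiable at all points of the convex hull of `M`, their gradients
are `Lf`-Lipschitz there, and the gradients are bounded by `LG` on `M`. -/
structure GradientAssumption (M : Set E) {n : ℕ} (f : Fin n → E → ℝ) (Lf LG : ℝ) : Prop where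
  differentiableAt : ∀ i, ∀ x ∈ convexHull ℝ M, DifferentiableAt ℝ (f i) x
  lipschitz : ∀ i, ∀ x ∈ convexHull ℝ M, ∀ y ∈ convexHull ℝ M,
    ‖∇ (f i) x - ∇ (f i) y‖ ≤ Lf * ‖x - y‖
  bounded : ∀ i, ∀ x ∈ M, ‖∇ (f i) x‖ ≤ LG

end RiemannianBound

end

/-! ### Tangent spaces, tangent projections and second-order contact along normals. -/

namespace RiemannianBound

open Filter Topology Metric Set ContinuousLinearMap

variable {E : Type*} [NormedAddCommGroup E] [InnerProductSpace ℝ E] [FiniteDimensional ℝ E]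

/-! Put `R = 2γ`. The segment from `x` to `y` lies in the convex hull, so the Euclidean descent
lemma applies. Splitting `∇ f x` into its tangential part, the Riemannian gradient, and a normal
part `v`, it remains to show `2R⟨v, y - x⟩ ≤ ‖v‖‖y - x‖²` (`inner_normal_le`).

For unit `v` this says that the open ball of radius `R` touching `M` at `x` in direction `v` misses
`M`. A local defining map gives this for some small radius. If the largest admissible radius `τ`
were below `R`, then, since the distance to `M` grows at unit speed inside the tube
(`exists_infDist_add_le`), some point within `ε` of the centre `x + τv` would be at distance at
least `τ + ε` from `M`, in particular from `x`. Only `x + (τ + ε)v` qualifies, so `τ + ε` would be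
admissible too.

The tangent spaces are locally kernels of differentials that vary in a Lipschitz way and have
adjoints uniformly bounded below; compactness globalizes the resulting local Lipschitz bound on the
projections. The gradient bound is then a product rule. -/

/-- The tangent space of a zero set of a submersion is the kernel of the differential. -/
theorem tangentSpace_eq_ker {k : ℕ} {M U : Set E} {x : E} (hU : IsOpen U)
    {h : E → EuclideanSpace ℝ (Fin k)} {A : E →L[ℝ] EuclideanSpace ℝ (Fin k)}
    (hA : HasStrictFDerivAt h A x) (hsurj : Function.Surjective A)
    (hMU : M ∩ U = {y ∈ U | h y = 0}) (hx : x ∈ M) (hxU : x ∈ U) :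
    tangentSpace M x = A.ker := by
  have hzero : ∀ y ∈ M, y ∈ U → h y = 0 := fun y hy hyU =>
    ((Set.ext_iff.1 hMU y).1 ⟨hy, hyU⟩).2
  apply le_antisymm
  · refine Submodule.span_le.2 ?_
    rintro v ⟨c, hc0, hcM, hcv⟩
    subst hc0
    have h1 : HasDerivAt (h ∘ c) (A v) 0 := hA.hasFDerivAt.comp_hasDerivAt 0 hcv
    have h2 : (h ∘ c) =ᶠ[𝓝 0] fun _ => 0 := by
      filter_upwards [hcM, hcv.continuousAt (hU.mem_nhds hxU)] with t ht htU
      exact hzero _ ht htU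
    have h3 : HasDerivAt (h ∘ c) 0 0 := (hasDerivAt_const (0 : ℝ) _).congr_of_eventuallyEq h2
    simpa using h1.unique h3
  · intro v hv
    have hr : A.range = ⊤ := LinearMap.range_eq_top.2 hsurj
    set φ := hA.implicitFunction h A hr with hφ
    have hlim : Tendsto (fun t : ℝ => t • (⟨v, hv⟩ : A.ker)) (𝓝 0) (𝓝 0) := by
      have : Continuous fun t : ℝ => t • (⟨v, hv⟩ : A.ker) := by fun_prop
      simpa using this.tendsto 0
    -- The implicit function parametrizes the level set of `h` through `x` by the kernel, with
    -- derivative at `0` the inclusion, so the image of the line `t • v` has velocity `v`.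
    refine Submodule.subset_span ⟨fun t => φ (h x) (t • ⟨v, hv⟩), by simp [hφ], ?_, ?_⟩
    · have e1 : ∀ᶠ t : ℝ in 𝓝 0, h (φ (h x) (t • ⟨v, hv⟩)) = h x :=
        ((tendsto_const_nhds (x := h x)).prodMk_nhds hlim).eventually
          (hA.map_implicitFunction_eq hr)
      have e2 : Tendsto (fun t : ℝ => φ (h x) (t • ⟨v, hv⟩)) (𝓝 0) (𝓝 x) :=
        hA.tendsto_implicitFunction hr tendsto_const_nhds hlim
      filter_upwards [e1, e2 (hU.mem_nhds hxU)] with t ht htU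
      refine ((Set.ext_iff.1 hMU _).2 ⟨htU, ?_⟩).1
      rw [ht, hzero x hx hxU]
    · have d1 : HasFDerivAt (φ (h x)) A.ker.subtypeL ((0 : ℝ) • (⟨v, hv⟩ : A.ker)) := by
        simpa using (hA.to_implicitFunction hr).hasFDerivAt
      have d2 : HasDerivAt (fun t : ℝ => t • (⟨v, hv⟩ : A.ker)) (⟨v, hv⟩ : A.ker) 0 := by
        simpa using (hasDerivAt_id (0 : ℝ)).smul_const (⟨v, hv⟩ : A.ker)
      exact d1.comp_hasDerivAt 0 d2

/-- Around a point of a smooth submanifold there is a defining map whose differentials are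
Lipschitz, with adjoints bounded below uniformly. -/
theorem IsSmoothSubmanifold.exists_ball {k : ℕ} {M : Set E} (hM : IsSmoothSubmanifold k M)
    {x : E} (hx : x ∈ M) :
    ∃ ρ > 0, ∃ h : E → EuclideanSpace ℝ (Fin k), ∃ K ≥ 0, ∃ c > 0,
      (∀ y ∈ ball x ρ, DifferentiableAt ℝ h y) ∧
      (∀ y ∈ ball x ρ, ∀ z ∈ ball x ρ, ‖fderiv ℝ h y - fderiv ℝ h z‖ ≤ K * ‖y - z‖) ∧
      (∀ y ∈ ball x ρ, ∀ w, c * ‖w‖ ≤ ‖adjoint (fderiv ℝ h y) w‖) ∧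
      ∀ y ∈ M, y ∈ ball x ρ → h y = 0 ∧ tangentSpace M y = (fderiv ℝ h y).ker := by
  obtain ⟨U, hU, hxU, h, hh, hsurj, hMU⟩ := hM x hx
  have hcd : ∀ y ∈ U, ContDiffAt ℝ ∞ h y := fun y hy => hh.contDiffAt (hU.mem_nhds hy)
  have hcd' : ContDiffAt ℝ 1 (fderiv ℝ h) x := (hcd x hxU).fderiv_right (by norm_cast)
  obtain ⟨K, s, hs, hK⟩ := hcd'.exists_lipschitzOnWith
  have hinj : (adjoint (fderiv ℝ h x)).ker = ⊥ := by
    rw [← orthogonal_range, LinearMap.range_eq_top.2 (hsurj x hxU), Submodule.top_orthogonal_eq_bot]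
  obtain ⟨C, hC, hanti⟩ := LinearMap.exists_antilipschitzWith
    (adjoint (fderiv ℝ h x)).toLinearMap hinj
  have hC' : (0 : ℝ) < C := hC
  -- The adjoint at `x` is bounded below by `1/C`; a perturbation of at most half of that leaves the
  -- bound `1/(2C)` nearby.
  have hclose : ∀ᶠ y in 𝓝 x, ‖fderiv ℝ h y - fderiv ℝ h x‖ < (2 * C : ℝ)⁻¹ := by
    have := (hcd'.continuousAt.sub (continuousAt_const (y := fderiv ℝ h x))).norm
    refine this.eventually_lt continuousAt_const ?_
    simp [hC']
  obtain ⟨ρ, hρ, hball⟩ := Metric.eventually_nhds_iff_ball.1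
    ((hU.eventually_mem hxU).and (hclose.and hs))
  refine ⟨ρ, hρ, h, K, K.2, (2 * C : ℝ)⁻¹, by positivity,
    fun y hy => (hcd y (hball y hy).1).differentiableAt (by simp),
    fun y hy z hz => ?_, fun y hy w => ?_, fun y hy hyb => ⟨?_, ?_⟩⟩
  · simpa [dist_eq_norm] using hK.dist_le_mul y (hball y hy).2.2 z (hball z hz).2.2
  · have h1 : ‖w‖ ≤ C * ‖adjoint (fderiv ℝ h x) w‖ := by
      simpa [dist_eq_norm] using hanti.le_mul_dist w 0
    have h2 : ‖adjoint (fderiv ℝ h y) w - adjoint (fderiv ℝ h x) w‖ ≤ (2 * C : ℝ)⁻¹ * ‖w‖ := by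
      rw [← _root_.sub_apply, ← map_sub]
      refine (le_opNorm _ _).trans ?_
      rw [LinearIsometryEquiv.norm_map]
      gcongr
      exact (hball y hy).2.1.le
    have h3 := norm_sub_norm_le (adjoint (fderiv ℝ h x) w) (adjoint (fderiv ℝ h y) w)
    rw [norm_sub_rev] at h3
    have h4 : (C : ℝ)⁻¹ * ‖w‖ ≤ ‖adjoint (fderiv ℝ h x) w‖ := by
      rwa [inv_mul_le_iff₀ hC']
    have h5 : (C : ℝ)⁻¹ = 2 * (2 * C : ℝ)⁻¹ := by field_simp
    rw [h5] at h4
    linarith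
  · exact ((Set.ext_iff.1 hMU y).1 ⟨hy, (hball y hyb).1⟩).2
  · exact tangentSpace_eq_ker hU ((hcd y (hball y hyb).1).hasStrictFDerivAt (by simp))
      (hsurj y (hball y hyb).1) hMU hy (hball y hyb).1

theorem exists_adjoint_eq_of_mem_orthogonal_ker {F : Type*} [NormedAddCommGroup F]
    [InnerProductSpace ℝ F] [FiniteDimensional ℝ F] (A : E →L[ℝ] F) {v : E} (hv : v ∈ A.kerᗮ) :
    ∃ w, adjoint A w = v := by
  rw [orthogonal_ker, (Submodule.closed_of_finiteDimensional _).submodule_topologicalClosure_eq]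
    at hv
  exact hv

/-- The projection onto the kernel of a surjection depends on it in a Lipschitz way, one-sided
version. -/
theorem norm_starProjection_ker_le {F : Type*} [NormedAddCommGroup F]
    [InnerProductSpace ℝ F] [FiniteDimensional ℝ F] (A B : E →L[ℝ] F) {c : ℝ} (hc : 0 < c)
    (hB : ∀ w, c * ‖w‖ ≤ ‖adjoint B w‖) {v : E} (hv : v ∈ B.kerᗮ) :
    ‖A.ker.starProjection v‖ ≤ c⁻¹ * ‖A - B‖ * ‖v‖ := by
  obtain ⟨w, rfl⟩ := exists_adjoint_eq_of_mem_orthogonal_ker B hv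
  -- `adjoint A w` is normal to `A.ker`, so the projection sees only the difference `adjoint (B - A)
  -- w`.
  have h0 : A.ker.starProjection (adjoint A w) = 0 := by
    rw [Submodule.starProjection_apply_eq_zero_iff, Submodule.mem_orthogonal]
    intro u hu
    rw [adjoint_inner_right, show A u = 0 from hu, inner_zero_left]
  have h1 : A.ker.starProjection (adjoint B w) = A.ker.starProjection (adjoint (B - A) w) := by
    rw [map_sub adjoint, _root_.sub_apply, map_sub, h0, sub_zero]
  rw [h1]
  calc ‖A.ker.starProjection (adjoint (B - A) w)‖ ≤ ‖adjoint (B - A) w‖ :=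
        A.ker.norm_starProjection_apply_le _
    _ ≤ ‖A - B‖ * ‖w‖ := by
        refine (le_opNorm _ _).trans_eq ?_
        rw [LinearIsometryEquiv.norm_map, norm_sub_rev]
    _ ≤ ‖A - B‖ * (c⁻¹ * ‖adjoint B w‖) := by
        gcongr
        rw [le_inv_mul_iff₀ hc]
        exact hB w
    _ = _ := by ring

/-- The difference equals `P_S P_{T⊥} - P_{S⊥} P_T`, and the second product is the adjoint of `P_T
P_{S⊥}`; each hypothesis controls one term. -/
theorem norm_starProjection_sub_starProjection_le (S T : Submodule ℝ E) {b : ℝ} (hb : 0 ≤ b)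
    (h₁ : ∀ v ∈ Tᗮ, ‖S.starProjection v‖ ≤ b * ‖v‖)
    (h₂ : ∀ v ∈ Sᗮ, ‖T.starProjection v‖ ≤ b * ‖v‖) :
    ‖S.starProjection - T.starProjection‖ ≤ 2 * b := by
  have key : ∀ S T : Submodule ℝ E, (∀ v ∈ Tᗮ, ‖S.starProjection v‖ ≤ b * ‖v‖) →
      ‖S.starProjection ∘L Tᗮ.starProjection‖ ≤ b := fun S T h =>
    opNorm_le_bound _ hb fun v =>
      (h _ (Tᗮ.starProjection_apply_mem v)).trans (by
        gcongr
        exact Tᗮ.norm_starProjection_apply_le _)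
  have hadj : ‖Sᗮ.starProjection ∘L T.starProjection‖ ≤ b := by
    have : Sᗮ.starProjection ∘L T.starProjection
        = adjoint (T.starProjection ∘L Sᗮ.starProjection) := by
      rw [adjoint_comp, (isSelfAdjoint_starProjection T).adjoint_eq,
        (isSelfAdjoint_starProjection Sᗮ).adjoint_eq]
    rw [this, LinearIsometryEquiv.norm_map]
    exact key T S h₂
  have hsplit : S.starProjection - T.starProjection
      = S.starProjection ∘L Tᗮ.starProjection - Sᗮ.starProjection ∘L T.starProjection := by
    ext v
    simp [Submodule.starProjection_orthogonal]
  rw [hsplit]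
  refine (norm_sub_le _ _).trans ?_
  linarith [key S T h₁]

/-- The tangent projection of a compact smooth submanifold is Lipschitz. -/
theorem IsSmoothSubmanifold.exists_isTangentProjectionModulus {k : ℕ} {M : Set E}
    (hM : IsSmoothSubmanifold k M) (hcpt : IsCompact M) :
    ∃ L : ℝ, 0 < L ∧ IsTangentProjectionModulus M L := by
  have hloc : LocallyLipschitzOn M fun x => (tangentSpace M x).starProjection := by
    intro x hx
    obtain ⟨ρ, hρ, h, K, hK, c, hc, -, hlip, hlow, hker⟩ := hM.exists_ball hx
    refine ⟨(2 * (c⁻¹ * K)).toNNReal, ball x ρ ∩ M,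
      inter_mem (mem_nhdsWithin_of_mem_nhds (ball_mem_nhds x hρ)) self_mem_nhdsWithin,
      LipschitzOnWith.of_dist_le_mul fun y hy z hz => ?_⟩
    rw [Real.coe_toNNReal _ (by positivity), dist_eq_norm, dist_eq_norm,
      (hker y hy.2 hy.1).2, (hker z hz.2 hz.1).2]
    refine (norm_starProjection_sub_starProjection_le _ _ (b := c⁻¹ * K * ‖y - z‖)
      (by positivity) (fun v hv => ?_) fun v hv => ?_).trans_eq (by ring)
    · refine (norm_starProjection_ker_le _ _ hc (hlow z hz.1) hv).trans ?_
      rw [mul_assoc c⁻¹ K]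
      gcongr
      exact hlip y hy.1 z hz.1
    · refine (norm_starProjection_ker_le _ _ hc (hlow y hy.1) hv).trans ?_
      rw [mul_assoc c⁻¹ K, norm_sub_rev y z]
      gcongr
      exact hlip z hz.1 y hy.1
  obtain ⟨K, hK⟩ := hloc.exists_lipschitzOnWith_of_compact hcpt
  refine ⟨K + 1, by positivity, fun x hx y hy => ?_⟩
  have := hK.dist_le_mul x hx y hy
  rw [dist_eq_norm, dist_eq_norm] at this
  nlinarith [norm_nonneg (x - y)]

theorem riemannianGradient_eq_starProjection (M : Set E) (f : E → ℝ) (x : E) :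
    riemannianGradient M f x = (tangentSpace M x).starProjection (∇ f x) := by
  refine (Submodule.eq_starProjection_of_mem_of_inner_eq_zero
    (K := tangentSpace M x) (Submodule.coe_mem _) fun w hw => ?_).symm
  have h1 : inner ℝ (riemannianGradient M f x) w = fderiv ℝ f x w :=
    InnerProductSpace.toDual_symm_apply (x := (⟨w, hw⟩ : tangentSpace M x))
      (y := (fderiv ℝ f x).comp (tangentSpace M x).subtypeL)
  have h2 : inner ℝ (∇ f x) w = fderiv ℝ f x w := inner_gradient_left
  unfold riemannianGradient at h1
  rw [inner_sub_left, h1, h2, sub_self]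

/-- Normal vectors are orthogonal to displacements inside the submanifold up to second order. -/
theorem IsSmoothSubmanifold.exists_inner_le_mul_norm_sq {k : ℕ} {M : Set E}
    (hM : IsSmoothSubmanifold k M) {x : E} (hx : x ∈ M) {v : E} (hv : v ∈ (tangentSpace M x)ᗮ) :
    ∃ C > 0, ∀ y ∈ M, inner ℝ v (y - x) ≤ C * ‖y - x‖ ^ 2 := by
  obtain ⟨ρ, hρ, h, K, hK, c, hc, hdiff, hlip, -, hker⟩ := hM.exists_ball hx
  have hxb : x ∈ ball x ρ := mem_ball_self hρ
  rw [(hker x hx hxb).2] at hv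
  obtain ⟨w, rfl⟩ := exists_adjoint_eq_of_mem_orthogonal_ker _ hv
  set v := adjoint (fderiv ℝ h x) w
  -- `K * ‖w‖` serves points within `ρ` of `x`, `‖v‖ / ρ` those farther away, and `1` ensures
  -- positivity.
  refine ⟨K * ‖w‖ + ‖v‖ / ρ + 1, by positivity, fun y hy => ?_⟩
  have hsq : 0 ≤ ‖y - x‖ ^ 2 := by positivity
  rcases lt_or_ge ‖y - x‖ ρ with hlt | hge
  · have hyb : y ∈ ball x ρ := mem_ball_iff_norm.2 hlt
    have hsub : segment ℝ x y ⊆ ball x ρ := (convex_ball x ρ).segment_subset hxb hyb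
    have hmv : ‖h y - h x - fderiv ℝ h x (y - x)‖ ≤ K * ‖y - x‖ * ‖y - x‖ :=
      Convex.norm_image_sub_le_of_norm_fderiv_le' (s := segment ℝ x y)
        (fun z hz => hdiff z (hsub hz))
        (fun z hz => (hlip z (hsub hz) x hxb).trans (by
          gcongr
          exact mem_closedBall_iff_norm.1 ((convex_closedBall x ‖y - x‖).segment_subset
            (mem_closedBall_self (norm_nonneg _)) (mem_closedBall_iff_norm.2 le_rfl) hz)))
        (convex_segment x y) (left_mem_segment ℝ x y) (right_mem_segment ℝ x y)
    rw [(hker y hy hyb).1, (hker x hx hxb).1, sub_zero, zero_sub, norm_neg] at hmv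
    have h1 : inner ℝ v (y - x) ≤ ‖w‖ * (K * ‖y - x‖ * ‖y - x‖) := by
      rw [adjoint_inner_left]
      exact (real_inner_le_norm _ _).trans (by gcongr)
    have h2 : 0 ≤ ‖v‖ / ρ * ‖y - x‖ ^ 2 := by positivity
    nlinarith
  · have h1 : inner ℝ v (y - x) ≤ ‖v‖ * ‖y - x‖ := real_inner_le_norm _ _
    have h2 : ‖v‖ * ‖y - x‖ ≤ ‖v‖ / ρ * ‖y - x‖ ^ 2 := by
      rw [div_mul_eq_mul_div, le_div_iff₀ hρ]
      nlinarith [norm_nonneg v, mul_nonneg (norm_nonneg v) (norm_nonneg (y - x))]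
    have h3 : 0 ≤ K * ‖w‖ * ‖y - x‖ ^ 2 := by positivity
    nlinarith

end RiemannianBound

/-! ### Nearest points and the distance function of a proximally smooth set. -/

namespace RiemannianBound

open Filter Topology Metric Set

section Normed

variable {E : Type*} [NormedAddCommGroup E]

theorem infDist_eq_of_mem_nearestPoints {M : Set E} {w y : E} (hy : y ∈ nearestPoints M w) :
    infDist w M = ‖y - w‖ := by
  apply le_antisymm
  · rw [← dist_eq_norm, dist_comm]
    exact infDist_le_dist_of_mem hy.1
  · refine (le_infDist ⟨y, hy.1⟩).2 fun z hz => ?_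
    rw [dist_comm, dist_eq_norm]
    exact hy.2 z hz

/-- A unique nearest point varies continuously. -/
theorem exists_nearestPoints_norm_sub_lt {M : Set E} (hcpt : IsCompact M) {w y : E}
    (hy : y ∈ nearestPoints M w) (huniq : ∀ y' ∈ nearestPoints M w, y' = y) {δ : ℝ} (hδ : 0 < δ) :
    ∃ s > 0, ∀ w', ‖w' - w‖ < s → ∀ y' ∈ nearestPoints M w', ‖y' - y‖ < δ := by
  rcases (M \ ball y δ).eq_empty_or_nonempty with he | hne
  · refine ⟨1, one_pos, fun w' _ y' hy' => ?_⟩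
    rw [← mem_ball_iff_norm]
    by_contra hn
    exact (Set.ext_iff.1 he y').1 ⟨hy'.1, hn⟩
  -- By compactness and uniqueness, points of `M` outside the ball are farther from `w` than `y` by
  -- a positive gap; moving `w` by less than half the gap cannot make them nearest.
  obtain ⟨p, hp, hpmin⟩ := (hcpt.diff isOpen_ball).exists_isMinOn hne
    (f := fun z => ‖z - w‖) (by fun_prop)
  have hlt : ‖y - w‖ < ‖p - w‖ := by
    refine lt_of_le_of_ne (hy.2 p hp.1) fun heq => hp.2 ?_
    have hpn : p ∈ nearestPoints M w := ⟨hp.1, fun z hz => heq ▸ hy.2 z hz⟩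
    rw [huniq p hpn]
    exact mem_ball_self hδ
  refine ⟨(‖p - w‖ - ‖y - w‖) / 2, by linarith, fun w' hw' y' hy' => ?_⟩
  rw [← mem_ball_iff_norm]
  by_contra hn
  have h1 : ‖p - w‖ ≤ ‖y' - w‖ := hpmin ⟨hy'.1, hn⟩
  have h2 : ‖y' - w'‖ ≤ ‖y - w'‖ := hy'.2 y hy.1
  have h3 : ‖y' - w‖ ≤ ‖y' - w'‖ + ‖w' - w‖ := norm_sub_le_norm_sub_add_norm_sub _ _ _
  have h4 : ‖y - w'‖ ≤ ‖y - w‖ + ‖w' - w‖ := by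
    rw [norm_sub_rev w' w]
    exact norm_sub_le_norm_sub_add_norm_sub _ _ _
  linarith

end Normed

variable {E : Type*} [NormedAddCommGroup E] [InnerProductSpace ℝ E]

/-- Off the set, inside the tube, the distance function increases with slope one in some
direction. -/
theorem IsProximallySmooth.exists_ascent {M : Set E} {R : ℝ} (h : IsProximallySmooth R M)
    (hcpt : IsCompact M) {w : E} (hw0 : 0 < infDist w M) (hwR : infDist w M < R) {η : ℝ}
    (hη : 0 < η) (hη1 : η < 1) :
    ∃ u : E, ‖u‖ = 1 ∧ ∃ s₀ > 0, ∀ s, 0 < s → s < s₀ →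
      infDist w M + (1 - η) * s ≤ infDist (w + s • u) M := by
  obtain ⟨y, hy, huniq⟩ := h.2 w hwR
  have hd : infDist w M = ‖w - y‖ := by
    rw [infDist_eq_of_mem_nearestPoints hy, norm_sub_rev]
  set d := infDist w M with hd_def
  -- The ascent direction is `u = (w - y)/d`. A nearest point `y'` this close to `y` makes the
  -- cosine between `w - y'` and `u` at least `1 - η`.
  obtain ⟨s₁, hs₁, hclose⟩ := exists_nearestPoints_norm_sub_lt hcpt hy huniq
    (δ := η * d / 2) (by positivity)
  have hu : ‖d⁻¹ • (w - y)‖ = 1 := by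
    rw [norm_smul, ← hd, norm_inv, Real.norm_of_nonneg hw0.le, inv_mul_cancel₀ hw0.ne']
  refine ⟨d⁻¹ • (w - y), hu, min s₁ (R - d), lt_min hs₁ (by linarith), fun s hs hs' => ?_⟩
  set u := d⁻¹ • (w - y) with hu_def
  have hwu : ‖w + s • u - w‖ = s := by
    rw [add_sub_cancel_left, norm_smul, hu, mul_one, Real.norm_of_nonneg hs.le]
  have hR : infDist (w + s • u) M < R := by
    have h1 : infDist (w + s • u) M ≤ infDist w M + dist (w + s • u) w :=
      infDist_le_infDist_add_dist
    rw [dist_eq_norm, hwu] at h1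
    linarith [hs'.trans_le (min_le_right _ _)]
  obtain ⟨y', hy', -⟩ := h.2 _ hR
  have hyy : ‖y' - y‖ < η * d / 2 :=
    hclose _ (hwu.trans_lt (hs'.trans_le (min_le_left _ _))) y' hy'
  rw [infDist_eq_of_mem_nearestPoints hy', norm_sub_rev]
  have hn1 : d ≤ ‖w - y'‖ := by
    rw [hd, norm_sub_rev w, norm_sub_rev w]
    exact hy.2 y' hy'.1
  have hn2 : ‖w - y'‖ ≤ d + η * d / 2 := by
    have := norm_sub_le_norm_sub_add_norm_sub w y y'
    rw [norm_sub_rev y y', ← hd] at this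
    linarith
  have hi1 : inner ℝ (w - y) u = d := by
    rw [hu_def, inner_smul_right, real_inner_self_eq_norm_sq, ← hd]
    field_simp
  have hi2 : inner ℝ (y' - y) u ≤ ‖y' - y‖ := by
    simpa [hu] using real_inner_le_norm (y' - y) u
  have hi3 : inner ℝ (w - y') u = d - inner ℝ (y' - y) u := by
    rw [← hi1, ← inner_sub_left]
    congr 1
    abel
  have hi : (1 - η) * ‖w - y'‖ ≤ inner ℝ (w - y') u := by
    have h1 : (1 - η) * ‖w - y'‖ ≤ (1 - η) * (d + η * d / 2) := by
      gcongr
    nlinarith [mul_pos (mul_pos hη hη) hw0]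
  have hpos : 0 < ‖w - y'‖ := hw0.trans_le hn1
  have hcs : ‖w - y'‖ * (‖w - y'‖ + (1 - η) * s) ≤ ‖w - y'‖ * ‖w + s • u - y'‖ := by
    have h1 := real_inner_le_norm (w - y') (w + s • u - y')
    rw [show w + s • u - y' = (w - y') + s • u by abel, inner_add_right,
      real_inner_self_eq_norm_sq, inner_smul_right] at h1
    rw [show w + s • u - y' = (w - y') + s • u by abel]
    nlinarith
  linarith [le_of_mul_le_mul_left hcs hpos]

/-- The distance function grows at unit speed: a ball inside the tube and off the set has a point
whose distance exceeds that of the centre by the radius. -/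
theorem IsProximallySmooth.exists_infDist_add_le [FiniteDimensional ℝ E] {M : Set E} {R : ℝ}
    (h : IsProximallySmooth R M)
    (hcpt : IsCompact M) {z : E} {ε : ℝ} (hε : 0 < ε) (hεz : ε < infDist z M)
    (hεR : infDist z M + ε < R) :
    ∃ w ∈ closedBall z ε, infDist z M + ε ≤ infDist w M := by
  have hball : IsCompact (closedBall z ε) := isCompact_closedBall z ε
  have hne : (closedBall z ε).Nonempty := ⟨z, mem_closedBall_self hε.le⟩
  have hcont : Continuous fun w => infDist w M := continuous_infDist_pt M
  have approx : ∀ η : ℝ, 0 < η → η < 1 →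
      ∃ w ∈ closedBall z ε, infDist z M + (1 - η) * ε ≤ infDist w M := by
    intro η hη hη1
    -- A maximizer of the penalized distance must lie on the sphere: at an interior one, an ascent
    -- of slope `1 - η/2` would beat the penalty of slope `1 - η`.
    obtain ⟨w, hw, hmax⟩ := hball.exists_isMaxOn hne
      (f := fun w => infDist w M - (1 - η) * ‖w - z‖)
      (by fun_prop)
    have hwz : ‖w - z‖ ≤ ε := mem_closedBall_iff_norm.1 hw
    have hge : infDist z M ≤ infDist w M - (1 - η) * ‖w - z‖ := by
      simpa using hmax (mem_closedBall_self hε.le)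
    refine ⟨w, hw, ?_⟩
    rcases hwz.eq_or_lt with heq | hlt
    · rw [heq] at hge
      linarith
    exfalso
    have hd1 : infDist z M ≤ infDist w M + dist z w := infDist_le_infDist_add_dist
    have hd2 : infDist w M ≤ infDist z M + dist w z := infDist_le_infDist_add_dist
    rw [dist_comm, dist_eq_norm] at hd1
    rw [dist_eq_norm] at hd2
    obtain ⟨u, hu, s₀, hs₀, hs⟩ := h.exists_ascent hcpt (w := w) (by linarith) (by linarith)
      (η := η / 2) (by positivity) (by linarith)
    obtain ⟨s, hs1, hs2⟩ := exists_between (lt_min hs₀ (sub_pos.2 hlt))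
    have hasc := hs s hs1 (hs2.trans_le (min_le_left _ _))
    have hsε := hs2.trans_le (min_le_right _ _)
    have hnorm : ‖w + s • u - z‖ ≤ ‖w - z‖ + s := by
      rw [show w + s • u - z = (w - z) + s • u by abel]
      refine (norm_add_le _ _).trans_eq ?_
      rw [norm_smul, hu, mul_one, Real.norm_of_nonneg hs1.le]
    have hle : infDist (w + s • u) M - (1 - η) * ‖w + s • u - z‖
        ≤ infDist w M - (1 - η) * ‖w - z‖ :=
      hmax (mem_closedBall_iff_norm.2 (by linarith))
    have : (1 - η) * ‖w + s • u - z‖ ≤ (1 - η) * (‖w - z‖ + s) := by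
      gcongr
    nlinarith [mul_pos hη hs1]
  -- A maximizer of the distance itself dominates the approximate points for every `η`, so `η` can
  -- tend to `0`.
  obtain ⟨w, hw, hmax⟩ := hball.exists_isMaxOn hne hcont.continuousOn
  refine ⟨w, hw, le_of_forall_pos_lt_add fun τ hτ => ?_⟩
  obtain ⟨η, hη, hη1⟩ := exists_between (lt_min one_pos (div_pos hτ hε))
  obtain ⟨w', hw', hle⟩ := approx η hη (hη1.trans_le (min_le_left _ _))
  have h1 : infDist w' M ≤ infDist w M := hmax hw'
  have h2 := (lt_div_iff₀ hε).1 (hη1.trans_le (min_le_right _ _))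
  linarith

/-- The ball of radius `t` touching at `x` in the unit direction `v` does not meet `M`, expressed
through inner products. -/
theorem le_infDist_add_smul_iff {M : Set E} {x v : E} (hx : x ∈ M) (hv : ‖v‖ = 1)
    {t : ℝ} (ht : 0 ≤ t) :
    t ≤ infDist (x + t • v) M ↔ ∀ z ∈ M, 2 * t * inner ℝ v (z - x) ≤ ‖z - x‖ ^ 2 := by
  rw [le_infDist ⟨x, hx⟩]
  refine forall₂_congr fun z _ => ?_
  have hsq : ‖x + t • v - z‖ ^ 2 = t ^ 2 - 2 * t * inner ℝ v (z - x) + ‖z - x‖ ^ 2 := by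
    rw [show x + t • v - z = t • v - (z - x) by abel, norm_sub_sq_real, norm_smul, hv, mul_one,
      Real.norm_of_nonneg ht, inner_smul_left, conj_trivial]
    ring
  rw [dist_eq_norm, ← pow_le_pow_iff_left₀ ht (norm_nonneg _) two_ne_zero, hsq]
  constructor <;> intro h <;> linarith

/-- If a ball touches `M` at `x`, then so does every ball with the same normal of radius less than
the proximal radius. -/
theorem IsProximallySmooth.inner_le_norm_sq [FiniteDimensional ℝ E] {M : Set E} {R : ℝ}
    (h : IsProximallySmooth R M) (hR : 0 < R)
    (hcpt : IsCompact M) {x v : E} (hx : x ∈ M) (hv : ‖v‖ = 1)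
    {C : ℝ} (hC : 0 < C) (hquad : ∀ z ∈ M, inner ℝ v (z - x) ≤ C * ‖z - x‖ ^ 2) :
    ∀ z ∈ M, 2 * R * inner ℝ v (z - x) ≤ ‖z - x‖ ^ 2 := by
  have hTc : IsCompact {t ∈ Icc 0 R | ∀ z ∈ M, 2 * t * inner ℝ v (z - x) ≤ ‖z - x‖ ^ 2} := by
    have hset : {t : ℝ | ∀ z ∈ M, 2 * t * inner ℝ v (z - x) ≤ ‖z - x‖ ^ 2}
        = ⋂ z ∈ M, {t | 2 * t * inner ℝ v (z - x) ≤ ‖z - x‖ ^ 2} := by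
      ext t
      simp
    refine isCompact_Icc.inter_right (t := {t : ℝ | ∀ z ∈ M, _}) ?_
    rw [hset]
    exact isClosed_biInter fun z _ => isClosed_le (by fun_prop) (by fun_prop)
  have hT0 : min R (2 * C)⁻¹ ∈
      {t ∈ Icc 0 R | ∀ z ∈ M, 2 * t * inner ℝ v (z - x) ≤ ‖z - x‖ ^ 2} := by
    have hpos : 0 < min R (2 * C)⁻¹ := lt_min hR (by positivity)
    refine ⟨⟨hpos.le, min_le_left _ _⟩, fun z hz => ?_⟩
    calc 2 * min R (2 * C)⁻¹ * inner ℝ v (z - x)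
        ≤ 2 * min R (2 * C)⁻¹ * (C * ‖z - x‖ ^ 2) := by
          gcongr
          exact hquad z hz
      _ ≤ 2 * (2 * C)⁻¹ * (C * ‖z - x‖ ^ 2) := by
          gcongr
          exact min_le_right _ _
      _ = ‖z - x‖ ^ 2 := by field_simp
  -- `τ` is the largest admissible radius in `[0, R]`; the quadratic bound makes it positive.
  obtain ⟨τ, ⟨⟨hτ0, hτR⟩, hτ⟩, hmax⟩ := hTc.exists_isGreatest ⟨_, hT0⟩
  have hτpos : 0 < τ := (lt_min hR (by positivity)).trans_le (hmax hT0)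
  rcases hτR.eq_or_lt with rfl | hlt
  · exact hτ
  exfalso
  obtain ⟨ε, hε, hε'⟩ := exists_between (lt_min hτpos (sub_pos.2 hlt))
  have hετ := hε'.trans_le (min_le_left _ _)
  have hεR := hε'.trans_le (min_le_right _ _)
  have hz : infDist (x + τ • v) M = τ := by
    refine le_antisymm ?_ ((le_infDist_add_smul_iff hx hv hτ0).2 hτ)
    refine (infDist_le_dist_of_mem hx).trans_eq ?_
    rw [dist_eq_norm, add_sub_cancel_left, norm_smul, hv, mul_one, Real.norm_of_nonneg hτ0]
  obtain ⟨w, hw, hwd⟩ := h.exists_infDist_add_le hcpt (z := x + τ • v) hε (by rwa [hz])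
    (by rw [hz]; linarith)
  rw [hz] at hwd
  obtain ⟨q, rfl⟩ : ∃ q, w = x + τ • v + q := ⟨w - (x + τ • v), by abel⟩
  have hq : ‖q‖ ≤ ε := by simpa using mem_closedBall_iff_norm.1 hw
  have hq2 : ‖q‖ ^ 2 ≤ ε ^ 2 := by gcongr
  -- With `‖q‖ ≤ ε` this is equality in the triangle inequality, which forces `q = ε • v`.
  have hfar : τ + ε ≤ ‖τ • v + q‖ := by
    refine hwd.trans ((infDist_le_dist_of_mem hx).trans_eq ?_)
    rw [dist_eq_norm]
    congr 1
    abel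
  have hfar2 : (τ + ε) ^ 2 ≤ ‖τ • v + q‖ ^ 2 := by gcongr
  rw [norm_add_sq_real, norm_smul, hv, mul_one, Real.norm_of_nonneg hτ0, inner_smul_left,
    conj_trivial] at hfar2
  have hinner : ε ≤ inner ℝ v q := le_of_mul_le_mul_left (by nlinarith) hτpos
  have hqv : q = ε • v := by
    rw [← sub_eq_zero, ← norm_eq_zero, ← sq_eq_zero_iff]
    refine le_antisymm ?_ (by positivity)
    rw [norm_sub_sq_real, norm_smul, hv, mul_one, Real.norm_of_nonneg hε.le, inner_smul_right,
      real_inner_comm]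
    nlinarith
  rw [hqv, add_assoc, ← add_smul] at hwd
  have hmem := hmax ⟨⟨by linarith, by linarith⟩,
    (le_infDist_add_smul_iff hx hv (by linarith)).1 hwd⟩
  linarith

end RiemannianBound

/-! ### Normal inequality, descent lemma and the two gradient bounds. -/

namespace RiemannianBound

open Filter Topology Metric Set

variable {E : Type*} [NormedAddCommGroup E] [InnerProductSpace ℝ E] [FiniteDimensional ℝ E]

/-- Normal vectors of a proximally smooth submanifold are proximal normals with the radius of
proximal smoothness. -/
theorem IsSmoothSubmanifold.inner_normal_le {k : ℕ} {M : Set E} (hM : IsSmoothSubmanifold k M)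
    (hcpt : IsCompact M) {R : ℝ} (hR : 0 < R) (hprox : IsProximallySmooth R M) {x : E}
    (hx : x ∈ M) {v : E} (hv : v ∈ (tangentSpace M x)ᗮ) {y : E} (hy : y ∈ M) :
    2 * R * inner ℝ v (y - x) ≤ ‖v‖ * ‖y - x‖ ^ 2 := by
  rcases eq_or_ne v 0 with rfl | hv0
  · simp
  have hpos : 0 < ‖v‖ := norm_pos_iff.2 hv0
  obtain ⟨C, hC, hquad⟩ := hM.exists_inner_le_mul_norm_sq hx
    (Submodule.smul_mem _ ‖v‖⁻¹ hv)
  have hunit : ‖‖v‖⁻¹ • v‖ = 1 := norm_smul_inv_norm (𝕜 := ℝ) hv0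
  have := hprox.inner_le_norm_sq hR hcpt hx hunit hC hquad y hy
  rw [inner_smul_left, conj_trivial] at this
  calc 2 * R * inner ℝ v (y - x) = ‖v‖ * (2 * R * (‖v‖⁻¹ * inner ℝ v (y - x))) := by
        field_simp
    _ ≤ _ := by gcongr

/-- The descent lemma along a segment. -/
theorem sub_le_inner_gradient_add {f : E → ℝ} {x y : E} {L : ℝ}
    (hdiff : ∀ z ∈ segment ℝ x y, DifferentiableAt ℝ f z)
    (hlip : ∀ z ∈ segment ℝ x y, ‖∇ f z - ∇ f x‖ ≤ L * ‖z - x‖) :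
    f y - f x ≤ inner ℝ (∇ f x) (y - x) + L / 2 * ‖y - x‖ ^ 2 := by
  -- The linear and quadratic corrections make `φ` antitone on `[0, 1]`; the claim is `φ 1 ≤ φ 0`.
  set φ : ℝ → ℝ := fun t =>
    f (x + t • (y - x)) - t * inner ℝ (∇ f x) (y - x) - L / 2 * ‖y - x‖ ^ 2 * t ^ 2 with hφ
  have hseg : ∀ t ∈ Icc (0 : ℝ) 1, x + t • (y - x) ∈ segment ℝ x y := fun t ht => by
    rw [segment_eq_image']
    exact ⟨t, ht, rfl⟩
  have hderiv : ∀ t ∈ Icc (0 : ℝ) 1, HasDerivAt φ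
      (inner ℝ (∇ f (x + t • (y - x))) (y - x) - inner ℝ (∇ f x) (y - x)
        - L / 2 * ‖y - x‖ ^ 2 * (2 * t)) t := by
    intro t ht
    have h1 : HasDerivAt (fun t : ℝ => x + t • (y - x)) (y - x) t := by
      simpa using ((hasDerivAt_id t).smul_const (y - x)).const_add x
    have h2 := (hdiff _ (hseg t ht)).hasFDerivAt.comp_hasDerivAt t h1
    rw [← inner_gradient_left] at h2
    have h3 : HasDerivAt (fun t : ℝ => t * inner ℝ (∇ f x) (y - x)) (inner ℝ (∇ f x) (y - x)) t := by
      simpa using (hasDerivAt_id t).mul_const (inner ℝ (∇ f x) (y - x))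
    have h4 : HasDerivAt (fun t : ℝ => L / 2 * ‖y - x‖ ^ 2 * t ^ 2)
        (L / 2 * ‖y - x‖ ^ 2 * (2 * t)) t := by
      simpa using (hasDerivAt_pow 2 t).const_mul (L / 2 * ‖y - x‖ ^ 2)
    exact (h2.sub h3).sub h4
  have hanti : AntitoneOn φ (Icc 0 1) := by
    refine antitoneOn_of_deriv_nonpos (convex_Icc 0 1)
      (fun t ht => (hderiv t ht).continuousAt.continuousWithinAt)
      (fun t ht => (hderiv t (interior_subset ht)).differentiableAt.differentiableWithinAt)
      fun t ht => ?_
    have ht' : t ∈ Icc (0 : ℝ) 1 := interior_subset ht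
    rw [(hderiv t ht').deriv, ← inner_sub_left]
    have h1 := real_inner_le_norm (∇ f (x + t • (y - x)) - ∇ f x) (y - x)
    have h2 := hlip _ (hseg t ht')
    rw [add_sub_cancel_left, norm_smul, Real.norm_of_nonneg ht'.1] at h2
    have h3 := mul_le_mul_of_nonneg_right h2 (norm_nonneg (y - x))
    nlinarith
  have := hanti (left_mem_Icc.2 zero_le_one) (right_mem_Icc.2 zero_le_one) zero_le_one
  simp only [hφ, one_smul, add_sub_cancel, zero_smul, add_zero] at this
  linarith

/-- The quadratic upper bound for a smooth function on a proximally smooth submanifold. -/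
theorem IsSmoothSubmanifold.sub_le_inner_riemannianGradient {k : ℕ} {M : Set E}
    (hM : IsSmoothSubmanifold k M) (hcpt : IsCompact M) {R : ℝ} (hR : 0 < R)
    (hprox : IsProximallySmooth R M) {n : ℕ} {f : Fin n → E → ℝ} {Lf LG : ℝ}
    (hf : GradientAssumption M f Lf LG) (i : Fin n) {x y : E} (hx : x ∈ M) (hy : y ∈ M) :
    f i y - f i x ≤ inner ℝ (riemannianGradient M (f i) x) (y - x)
      + (Lf + 1 / R * LG) / 2 * ‖y - x‖ ^ 2 := by
  have hseg : segment ℝ x y ⊆ convexHull ℝ M := segment_subset_convexHull hx hy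
  have h1 := sub_le_inner_gradient_add (f := f i) (x := x) (y := y) (L := Lf)
    (fun z hz => hf.differentiableAt i z (hseg hz))
    (fun z hz => hf.lipschitz i z (hseg hz) x (subset_convexHull ℝ M hx))
  set g := ∇ (f i) x
  set T := tangentSpace M x
  have h2 := hM.inner_normal_le hcpt hR hprox hx (Tᗮ.starProjection_apply_mem g) hy
  have h3 : ‖Tᗮ.starProjection g‖ ≤ LG :=
    (Tᗮ.norm_starProjection_apply_le g).trans (hf.bounded i x hx)
  have h4 : inner ℝ (Tᗮ.starProjection g) (y - x) ≤ 1 / R * LG / 2 * ‖y - x‖ ^ 2 := by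
    have h5 := h2.trans (mul_le_mul_of_nonneg_right h3 (sq_nonneg ‖y - x‖))
    rw [← mul_le_mul_iff_right₀ (show 0 < 2 * R by positivity)]
    refine h5.trans_eq ?_
    field_simp
  have h6 : inner ℝ g (y - x)
      = inner ℝ (T.starProjection g) (y - x) + inner ℝ (Tᗮ.starProjection g) (y - x) := by
    rw [← inner_add_left, Submodule.starProjection_add_starProjection_orthogonal]
  rw [riemannianGradient_eq_starProjection]
  linarith

/-- The Riemannian gradient is Lipschitz when the tangent projection is. -/
theorem norm_riemannianGradient_sub_le {M : Set E} {n : ℕ} {f : Fin n → E → ℝ} {Lf LG L : ℝ}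
    (hf : GradientAssumption M f Lf LG) (hL : IsTangentProjectionModulus M L) (i : Fin n)
    {x y : E} (hx : x ∈ M) (hy : y ∈ M) :
    ‖riemannianGradient M (f i) x - riemannianGradient M (f i) y‖
      ≤ (Lf + LG * L) * ‖x - y‖ := by
  rw [riemannianGradient_eq_starProjection, riemannianGradient_eq_starProjection]
  set S := tangentSpace M x
  set T := tangentSpace M y
  -- One factor changes at a time: the gradient under a fixed projection, then the projection at the
  -- fixed gradient.
  have hsplit : S.starProjection (∇ (f i) x) - T.starProjection (∇ (f i) y)
      = S.starProjection (∇ (f i) x - ∇ (f i) y)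
        + (S.starProjection - T.starProjection) (∇ (f i) y) := by
    rw [map_sub, _root_.sub_apply]
    abel
  have h1 : ‖S.starProjection (∇ (f i) x - ∇ (f i) y)‖ ≤ Lf * ‖x - y‖ :=
    (S.norm_starProjection_apply_le _).trans
      (hf.lipschitz i x (subset_convexHull ℝ M hx) y (subset_convexHull ℝ M hy))
  have h2 : ‖(S.starProjection - T.starProjection) (∇ (f i) y)‖ ≤ L * ‖x - y‖ * LG :=
    (ContinuousLinearMap.le_opNorm _ _).trans <|
      mul_le_mul (hL x hx y hy) (hf.bounded i y hy) (norm_nonneg _)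
        ((norm_nonneg _).trans (hL x hx y hy))
  rw [hsplit]
  refine (norm_add_le _ _).trans ((add_le_add h1 h2).trans_eq ?_)
  ring

end RiemannianBound

theorem mainTheorem2 {d r k : ℕ} (M : Set (RiemannianBound.MatSpace d r))
    (hM : RiemannianBound.IsSmoothSubmanifold k M) (hcpt : IsCompact M)
    (γ : ℝ) (hγ : 0 < γ) (hprox : RiemannianBound.IsProximallySmooth (2 * γ) M) :
    (∃ LP : ℝ, 0 < LP ∧ RiemannianBound.IsTangentProjectionModulus M LP) ∧
    ∀ (n : ℕ) (f : Fin n → RiemannianBound.MatSpace d r → ℝ) (Lf LG : ℝ),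
      RiemannianBound.GradientAssumption M f Lf LG → ∀ i : Fin n,
        (∀ x ∈ M, ∀ y ∈ M,
          f i y - f i x ≤ inner ℝ (RiemannianBound.riemannianGradient M (f i) x) (y - x)
            + (Lf + 1 / (2 * γ) * LG) / 2 * ‖y - x‖ ^ 2) ∧
        (∀ LP : ℝ, 0 < LP → RiemannianBound.IsTangentProjectionModulus M LP →
          ∀ x ∈ M, ∀ y ∈ M,
            ‖RiemannianBound.riemannianGradient M (f i) x
              - RiemannianBound.riemannianGradient M (f i) y‖ ≤ (Lf + LG * LP) * ‖x - y‖) := by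

  refine ⟨hM.exists_isTangentProjectionModulus hcpt, fun n f Lf LG hf i =>
    ⟨fun x hx y hy => ?_, fun LP _ hLP x hx y hy => ?_⟩⟩
  · exact hM.sub_le_inner_riemannianGradient hcpt (by positivity) hprox hf i hx hy
  · exact RiemannianBound.norm_riemannianGradient_sub_le hf hLP i hx hy
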